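/- Let $p$ be a prime and let $G=S/R$, where $S$ is a free pro-$p$ group of finite rank $n$ and $R$ is a normal subgroup of $S$ with $R\subseteq S_{(3)}$ (with the quotient topology on $G$; if $R$ is closed, $G$ is a pro-$p$ group). Here $(S_{(m)})_{m\ge 1}$ is the Zassenhaus $p$-filtration, defined inductively by $S_{(1)}=S$ and $$S_{(m)}=S_{(\lceil m/p\rceil)}^{\,p}\prod_{i+j=m}[S_{(i)},S_{(j)}]\qquad(m\ge 2),$$ where $H^p$ and $[H,K]$ denote the smallest closed subgroups containing, respectively, all $p$-th powers $x^p$ ($x\in H$) and all commutators $x^{-1}y^{-1}xy$ ($x\in H$, $y\in K$). Let $U_4(\mathbb F_p)$ be the (discrete) group of upper-triangular unipotent $4\times 4$ matrices over $\mathbb F_p$, and let $\mathrm{Epi}(G,U_4(\mathbb F_p))$ be the set of continuous surjective homomorphisms $G\to U_4(\mathbb F_p)$. Let $H^i(G,\mathbb F_p)$ be the cohomology of inhomogeneous continuous cochains of $G$ with values in the trivial module $\mathbb F_p$, so that $H^1(G,\mathbb F_p)$ is the group of continuous homomorphisms $G\to\mathbb F_p$. For $a,b,c\in H^1(G,\mathbb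 F_p)$, the triple Massey product $\langle a,b,c\rangle\subseteq H^2(G,\mathbb F_p)$ is the set of all classes of $a\cup a_{24}+a_{13}\cup c$, where $a_{13},a_{24}$ are continuous $1$-cochains with $\delta a_{13}=a\cup b$ and $\delta a_{24}=b\cup c$; it is defined if such $a_{13},a_{24}$ exist. Let $\mathrm{TMP}(G,\mathbb F_p)$ be the set of triples $(a,b,c)\in H^1(G,\mathbb F_p)^3$ that are $\mathbb F_p$-linearly independent and such that $\langle a,b,c\rangle$ is defined and contains $0$. Then $\mathrm{Epi}(G,U_4(\mathbb F_p))$ and $\mathrm{TMP}(G,\mathbb F_p)$ are finite and $$|\mathrm{Epi}(G,U_4(\mathbb F_p))|=|\mathrm{TMP}(G,\mathbb F_p)|\cdot p^{3n}.$$ -/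

import Mathlib

namespace TripleMassey

/-- A topological group is pro-`p` if it is profinite and all its quotients by open normal
subgroups are (finite) `p`-groups. -/
structure IsProP (p : ℕ) (G : Type*) [Group G] [TopologicalSpace G] : Prop where
  topologicalGroup : IsTopologicalGroup G
  compact : CompactSpace G
  hausdorff : T2Space G
  totallyDisconnected : TotallyDisconnectedSpace G
  isPGroup_quotient : ∀ N : Subgroup G, ∀ _ : N.Normal, IsOpen (N : Set G) → IsPGroup p (G ⧸ N)

/-- `S` is the free pro-`p` group on the finite family `x` of `n` elements: it is pro-`p`, and
every map from the family to a pro-`p` group extends uniquely to a continuous homomorphism. -/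
structure IsFreeProPOn.{u} (p : ℕ) {n : ℕ} (S : Type u) [Group S] [TopologicalSpace S]
    (x : Fin n → S) : Prop where
  isProP : IsProP p S
  existsUnique_lift : ∀ (P : Type u) [Group P] [TopologicalSpace P], IsProP p P →
    ∀ y : Fin n → P, ∃! φ : S →ₜ* P, ∀ i, φ (x i) = y i

/-- `S` is a free pro-`p` group of rank `n`. -/
def IsFreeProPOfRank.{u} (p n : ℕ) (S : Type u) [Group S] [TopologicalSpace S] : Prop :=
  ∃ x : Fin n → S, IsFreeProPOn p S x

section Zassenhaus

variable {G : Type*} [Group G] [TopologicalSpace G] [IsTopologicalGroup G]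

/-- `H ^ p`: the smallest closed subgroup containing the `p`-th powers of elements of `H`. -/
def closedPower (p : ℕ) (H : Subgroup G) : Subgroup G :=
  (Subgroup.closure {g | ∃ x ∈ H, g = x ^ p}).topologicalClosure

/-- `[H, K]`: the smallest closed subgroup containing the commutators `x⁻¹ y⁻¹ x y`. -/
def closedCommutator (H K : Subgroup G) : Subgroup G :=
  (Subgroup.closure {g | ∃ x ∈ H, ∃ y ∈ K, g = x⁻¹ * y⁻¹ * x * y}).topologicalClosure

variable (G) in
/-- The Zassenhaus `p`-filtration: `G₍₁₎ = G` and
`G₍ₘ₎ = G₍⌈m/p⌉₎ ^ p * ∏_{i+j=m} [G₍ᵢ₎, G₍ⱼ₎]` for `m ≥ 2`, where `i, j ≥ 1`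
(the index `0` has no meaning and gets the value `G`). -/
def zassenhaus (p : ℕ) [hp : Fact p.Prime] (m : ℕ) : Subgroup G :=
  if _h : m ≤ 1 then ⊤
  else closedPower p (zassenhaus p (m ⌈/⌉ p)) ⊔
    ⨆ i : {i : ℕ // 1 ≤ i ∧ i < m},
      closedCommutator (zassenhaus p i.1) (zassenhaus p (m - i.1))
termination_by m
decreasing_by
  · have hp2 := hp.out.two_le
    have : m ⌈/⌉ p ≤ m - 1 := by
      rw [ceilDiv_le_iff_le_mul (by omega)]
      calc m ≤ 2 * (m - 1) := by omega
        _ ≤ p * (m - 1) := Nat.mul_le_mul_right _ hp2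
    omega
  · exact i.2.2
  · have := i.2.1
    omega

end Zassenhaus

section Unitriangular

/-- The group `U_m(R)` of all upper-triangular unipotent `m × m`-matrices over `R`. -/
def unitriangular (m : ℕ) (R : Type*) [CommRing R] : Subgroup (Matrix (Fin m) (Fin m) R)ˣ where
  carrier := {A | (∀ i j, j < i → A.val i j = 0) ∧ ∀ i, A.val i i = 1}
  one_mem' := ⟨fun i j h => by simp [h.ne'], fun i => by simp⟩
  mul_mem' := by
    rintro A B ⟨hA, hA'⟩ ⟨hB, hB'⟩
    refine ⟨fun i j hij => ?_, fun i => ?_⟩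
    · rw [Units.val_mul, Matrix.mul_apply]
      refine Finset.sum_eq_zero fun k _ => ?_
      rcases lt_or_ge k i with h | h
      · rw [hA i k h, zero_mul]
      · rw [hB k j (lt_of_lt_of_le hij h), mul_zero]
    · rw [Units.val_mul, Matrix.mul_apply, Finset.sum_eq_single i]
      · rw [hA', hB', one_mul]
      · intro k _ hk
        rcases lt_or_gt_of_ne hk with h | h
        · rw [hA i k h, zero_mul]
        · rw [hB k i h, mul_zero]
      · simp
  inv_mem' := by
    rintro A ⟨hA, hA'⟩
    have htri : ∀ i j, j < i → (A⁻¹).val i j = 0 := by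
      intro i j hij
      have hb : Matrix.BlockTriangular A.val id := fun i j h => hA i j h
      let _ : Invertible A.val := A.isUnit.invertible
      have := Matrix.blockTriangular_inv_of_blockTriangular hb
      rw [Matrix.coe_units_inv]
      exact this hij
    refine ⟨htri, fun i => ?_⟩
    have h1 : ((A⁻¹).val * A.val) i i = 1 := by
      rw [Units.inv_mul, Matrix.one_apply_eq]
    rw [Matrix.mul_apply, Finset.sum_eq_single i] at h1
    · rwa [hA', mul_one] at h1
    · intro k _ hk
      rcases lt_or_gt_of_ne hk with h | h
      · rw [htri i k h, zero_mul]
      · rw [hA k i h, mul_zero]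
    · simp

/-- `Epi(G, H)`: the set of continuous surjective homomorphisms from `G` to `H`. -/
def Epi (G H : Type*) [Group G] [TopologicalSpace G] [Group H] [TopologicalSpace H] :
    Set (G →ₜ* H) :=
  {φ | Function.Surjective φ}

end Unitriangular

section Massey

variable (p : ℕ) (G : Type*) [Group G] [TopologicalSpace G] [IsTopologicalGroup G]

/-- The coboundary `C¹ → C²` on inhomogeneous continuous cochains with values in the trivial
module `𝔽_p` (which carries the discrete topology): `(δa)(g, h) = a(h) - a(gh) + a(g)`. -/
def δ₁ : C(G, ZMod p) →ₗ[ZMod p] C(G × G, ZMod p) where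
  toFun a := ⟨fun x => a x.2 - a (x.1 * x.2) + a x.1, by fun_prop⟩
  map_add' a b := by ext x; simp; ring
  map_smul' c a := by ext x; simp; ring

/-- The coboundary `C² → C³`: `(δf)(g, h, k) = f(h, k) - f(gh, k) + f(g, hk) - f(g, h)`. -/
def δ₂ : C(G × G, ZMod p) →ₗ[ZMod p] C(G × G × G, ZMod p) where
  toFun f := ⟨fun x => f (x.2.1, x.2.2) - f (x.1 * x.2.1, x.2.2) + f (x.1, x.2.1 * x.2.2)
    - f (x.1, x.2.1), by fun_prop⟩
  map_add' a b := by ext x; simp; ring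
  map_smul' c a := by ext x; simp; ring

/-- `H¹(G, 𝔽_p) = Z¹(G, 𝔽_p)`: the coboundary `C⁰ → C¹` is zero because the action is trivial. -/
abbrev H1 : Type _ := LinearMap.ker (δ₁ p G)

/-- The module of continuous 2-cocycles. -/
abbrev Z2 : Submodule (ZMod p) C(G × G, ZMod p) := LinearMap.ker (δ₂ p G)

/-- The module of 2-coboundaries. -/
abbrev B2 : Submodule (ZMod p) C(G × G, ZMod p) := LinearMap.range (δ₁ p G)

/-- `H²(G, 𝔽_p)` as 2-cocycles modulo 2-coboundaries. -/
abbrev H2 : Type _ := Z2 p G ⧸ (B2 p G).submoduleOf (Z2 p G)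

theorem B2_le_Z2 : B2 p G ≤ Z2 p G := by
  rintro _ ⟨a, rfl⟩
  rw [LinearMap.mem_ker]
  ext x
  simp [δ₁, δ₂, mul_assoc]
  ring

variable {p G}

/-- The cup product of two 1-cochains: `(a ∪ b)(g, h) = a(g) b(h)`. -/
def cup (a b : C(G, ZMod p)) : C(G × G, ZMod p) := ⟨fun x => a x.1 * b x.2, by fun_prop⟩

/-- A defining system `{a₁₂, a₂₃, a₃₄, a₁₃, a₂₄}` for the triple Massey product `⟨a, b, c⟩`;
here `a₁₂ = a`, `a₂₃ = b`, `a₃₄ = c`. -/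
structure DefiningSystem (a b c : H1 p G) where
  a₁₃ : C(G, ZMod p)
  a₂₄ : C(G, ZMod p)
  δ_a₁₃ : δ₁ p G a₁₃ = cup a.1 b.1
  δ_a₂₄ : δ₁ p G a₂₄ = cup b.1 c.1

/-- The 2-cochain `a₁₂ ∪ a₂₄ + a₁₃ ∪ a₃₄`. -/
def DefiningSystem.cochain {a b c : H1 p G} (M : DefiningSystem a b c) : C(G × G, ZMod p) :=
  cup a.1 M.a₂₄ + cup M.a₁₃ c.1

theorem DefiningSystem.cochain_mem {a b c : H1 p G} (M : DefiningSystem a b c) :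
    M.cochain ∈ Z2 p G := by
  rw [LinearMap.mem_ker]
  ext ⟨g, h, k⟩
  have ha := DFunLike.congr_fun (LinearMap.mem_ker.1 a.2) (g, h)
  have hc := DFunLike.congr_fun (LinearMap.mem_ker.1 c.2) (h, k)
  have h1 := DFunLike.congr_fun M.δ_a₁₃ (g, h)
  have h2 := DFunLike.congr_fun M.δ_a₂₄ (h, k)
  simp only [δ₁, cup, LinearMap.coe_mk, AddHom.coe_mk, ContinuousMap.coe_mk,
    ContinuousMap.zero_apply] at ha hc h1 h2
  simp only [δ₂, DefiningSystem.cochain, cup, LinearMap.coe_mk, AddHom.coe_mk,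
    ContinuousMap.coe_mk, ContinuousMap.zero_apply, ContinuousMap.add_apply]
  linear_combination M.a₂₄ k * ha - a.1 g * h2 - M.a₁₃ g * hc + c.1 k * h1

/-- The value of the triple Massey product relative to a defining system. -/
def DefiningSystem.value {a b c : H1 p G} (M : DefiningSystem a b c) : H2 p G :=
  Submodule.Quotient.mk ⟨M.cochain, M.cochain_mem⟩

/-- The triple Massey product `⟨a, b, c⟩`, the subset of `H²(G, 𝔽_p)` of all its values. It is
defined when a defining system exists, i.e. when this set is nonempty. -/
def masseyProduct (a b c : H1 p G) : Set (H2 p G) :=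
  Set.range fun M : DefiningSystem a b c => M.value

variable (p G) in
/-- `TMP(G, 𝔽_p)`: the triples of linearly independent classes in `H¹(G, 𝔽_p)` whose triple
Massey product is defined and contains `0`. -/
def TMP : Set (H1 p G × H1 p G × H1 p G) :=
  {t | (masseyProduct t.1 t.2.1 t.2.2).Nonempty ∧ 0 ∈ masseyProduct t.1 t.2.1 t.2.2 ∧
    LinearIndependent (ZMod p) ![t.1, t.2.1, t.2.2]}

end Massey

end TripleMassey

/-! A homomorphism to `U_4(𝔽_p)` is, up to signs of entries, a defining system for `⟨a, b, c⟩`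
together with a cochain bounding its value: `a`, `b`, `c` stand next to the diagonal, `-a₁₃` and
`-a₂₄` above them, and the bounding cochain in the corner. Since the image of an epimorphism can be
detected modulo commutators, it is onto exactly when `a`, `b`, `c` are independent
(`surjective_iff_linearIndependent`).

It remains to count the homomorphisms over one triple in `TMP`. Fix one solution. Another choice of
`a₁₃`, `a₂₄` differs by classes `u`, `v` in `H¹`, which changes the value by `a ∪ v + u ∪ c`. If all
cup products vanish, this is a coboundary, so every `u`, `v` is allowed, and the corner is then free
up to a third class. Each fibre is thus a copy of `(H¹)³` (`exists_equiv_epi`).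

Cup products vanish because a homomorphism to the Heisenberg group kills `S₍₃₎`: prescribing it on
the basis and passing to `S ⧸ R` realizes `a ∪ b` as a coboundary (`IsFreeProPOn.exists_δ₁_eq_cup`).
The same lifts give `|H¹| = p ^ n`. -/

namespace TripleMassey

/-! ### Free pro-`p` groups and finite targets -/

section FreeProP

/-- A finite discrete `p`-group is pro-`p`. -/
theorem isProP_of_finite (p : ℕ) (H : Type*) [Group H] [TopologicalSpace H] [DiscreteTopology H]
    [Finite H] (hH : IsPGroup p H) : IsProP p H where
  topologicalGroup := inferInstance
  compact := inferInstance
  hausdorff := inferInstance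
  totallyDisconnected := inferInstance
  isPGroup_quotient N _ _ := hH.to_quotient N

/-- The universal property of a free pro-`p` group for finite discrete `p`-groups in
the lowest universe. -/
theorem IsFreeProPOn.existsUnique_lift_finite.{u} {p n : ℕ} {S : Type u} [Group S]
    [TopologicalSpace S] {x : Fin n → S} (hS : IsFreeProPOn p S x) (H : Type) [Group H]
    [TopologicalSpace H] [DiscreteTopology H] [Finite H] (hH : IsPGroup p H) (y : Fin n → H) :
    ∃! φ : S →ₜ* H, ∀ i, φ (x i) = y i := by
  -- The universal property only sees targets in the universe of `S`, so `H` is lifted there and the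
  -- result brought back.
  obtain ⟨φ, hφ, huniq⟩ := hS.existsUnique_lift (ULift.{u} H)
    (isProP_of_finite p _ (hH.of_equiv MulEquiv.ulift.symm)) (fun i => ULift.up (y i))
  refine ⟨⟨(MulEquiv.ulift (α := H)).toMonoidHom.comp φ.toMonoidHom, 
    continuous_uliftDown.comp φ.continuous⟩,
    fun i => congrArg ULift.down (hφ i), fun ψ hψ => ?_⟩
  have := huniq ⟨MulEquiv.ulift.symm.toMonoidHom.comp ψ.toMonoidHom,
    continuous_uliftUp.comp ψ.continuous⟩ (fun i => congrArg ULift.up (hψ i))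
  ext s
  change ψ s = (φ s).down
  rw [← this]
  rfl

end FreeProP

/-! ### Upper bounds for the Zassenhaus filtration -/

section Zassenhaus

theorem isClosed_ker {G H : Type*} [Group G] [TopologicalSpace G] [Group H] [TopologicalSpace H] [T1Space H]
    (φ : G →ₜ* H) :
    IsClosed (φ.toMonoidHom.ker : Set G) :=
  isClosed_singleton.preimage φ.continuous

variable {G : Type*} [Group G] [TopologicalSpace G] [IsTopologicalGroup G]

theorem closedPower_le {p : ℕ} {H K : Subgroup G} (hK : IsClosed (K : Set G))
    (h : ∀ x ∈ H, x ^ p ∈ K) : closedPower p H ≤ K := by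
  refine Subgroup.topologicalClosure_minimal _ ?_ hK
  rw [Subgroup.closure_le]
  rintro _ ⟨x, hx, rfl⟩
  exact h x hx

theorem closedCommutator_le {H H' K : Subgroup G} (hK : IsClosed (K : Set G))
    (h : ∀ x ∈ H, ∀ y ∈ H', x⁻¹ * y⁻¹ * x * y ∈ K) : closedCommutator H H' ≤ K := by
  refine Subgroup.topologicalClosure_minimal _ ?_ hK
  rw [Subgroup.closure_le]
  rintro _ ⟨x, hx, y, hy, rfl⟩
  exact h x hx y hy

theorem zassenhaus_le {p : ℕ} [Fact p.Prime] {m : ℕ} (hm : 2 ≤ m) {K : Subgroup G}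
    (hK : IsClosed (K : Set G)) (hpow : ∀ x ∈ zassenhaus G p (m ⌈/⌉ p), x ^ p ∈ K)
    (hcomm : ∀ i, 1 ≤ i → i < m → ∀ x ∈ zassenhaus G p i, ∀ y ∈ zassenhaus G p (m - i),
      x⁻¹ * y⁻¹ * x * y ∈ K) : zassenhaus G p m ≤ K := by
  rw [zassenhaus, dif_neg (by omega)]
  exact sup_le (closedPower_le hK hpow)
    (iSup_le fun i => closedCommutator_le hK (hcomm i.1 i.2.1 i.2.2))

/-- A continuous homomorphism to a discrete commutative group of exponent `p` kills `G₍₂₎`. -/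
theorem zassenhaus_two_le_ker {p : ℕ} [hp : Fact p.Prime] {H : Type*} [CommGroup H]
    [TopologicalSpace H] [T1Space H] (hH : ∀ h : H, h ^ p = 1) (φ : G →ₜ* H) :
    zassenhaus G p 2 ≤ φ.toMonoidHom.ker := by
  refine zassenhaus_le le_rfl (isClosed_ker φ) (fun x _ => ?_) fun i _ _ x _ y _ => ?_
  · rw [MonoidHom.mem_ker, map_pow, hH]
  · rw [MonoidHom.mem_ker]
    simp [mul_comm]

end Zassenhaus

/-! ### The Heisenberg group kills the third filtration step -/

section Heisenberg

/-- The Heisenberg group over `R`: upper-triangular unipotent `3 × 3`-matrices, given by their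
entries `a = a₁₂`, `b = a₂₃`, `c = a₁₃`. -/
@[ext]
structure Heis (R : Type*) where
  a : R
  b : R
  c : R

namespace Heis

variable {R : Type*}

/-- The Heisenberg group as a product. -/
def equivProd : Heis R ≃ R × R × R where
  toFun x := (x.a, x.b, x.c)
  invFun x := ⟨x.1, x.2.1, x.2.2⟩

instance [Finite R] : Finite (Heis R) := Finite.of_equiv _ equivProd.symm

instance : TopologicalSpace (Heis R) := ⊥

instance : DiscreteTopology (Heis R) := ⟨rfl⟩

variable [CommRing R]

instance : Mul (Heis R) := ⟨fun x y => ⟨x.a + y.a, x.b + y.b, x.c + y.c + x.a * y.b⟩⟩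

instance : One (Heis R) := ⟨⟨0, 0, 0⟩⟩

instance : Inv (Heis R) := ⟨fun x => ⟨-x.a, -x.b, -x.c + x.a * x.b⟩⟩

@[simp] theorem mul_a (x y : Heis R) : (x * y).a = x.a + y.a := rfl
@[simp] theorem mul_b (x y : Heis R) : (x * y).b = x.b + y.b := rfl
@[simp] theorem mul_c (x y : Heis R) : (x * y).c = x.c + y.c + x.a * y.b := rfl
@[simp] theorem one_a : (1 : Heis R).a = 0 := rfl
@[simp] theorem one_b : (1 : Heis R).b = 0 := rfl
@[simp] theorem one_c : (1 : Heis R).c = 0 := rfl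
@[simp] theorem inv_a (x : Heis R) : (x⁻¹).a = -x.a := rfl
@[simp] theorem inv_b (x : Heis R) : (x⁻¹).b = -x.b := rfl
@[simp] theorem inv_c (x : Heis R) : (x⁻¹).c = -x.c + x.a * x.b := rfl

instance : Group (Heis R) :=
  Group.ofLeftAxioms (fun x y z => by ext <;> simp <;> ring) (fun x => by ext <;> simp)
    (fun x => by ext <;> simp)

/-- Each pair of factors contributes one `a * b` to the corner, hence the binomial coefficient,
whose divisibility by `p` depends on whether `p = 2`. -/
theorem pow_eq (x : Heis R) (k : ℕ) :
    x ^ k = ⟨k * x.a, k * x.b, k * x.c + (k.choose 2 : ℕ) * (x.a * x.b)⟩ := by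
  induction k with
  | zero => ext <;> simp
  | succ k ih =>
    rw [pow_succ, ih]
    ext
    · simp; ring
    · simp; ring
    · simp [Nat.choose_succ_succ' k 1]; ring

theorem isPGroup (p : ℕ) [Fact p.Prime] : IsPGroup p (Heis (ZMod p)) := by
  refine IsPGroup.of_card (n := 3) ?_
  rw [Nat.card_congr equivProd]
  simp
  ring

/-- The projection to `a` as a homomorphism. -/
def homA (R : Type*) [CommRing R] [TopologicalSpace R] :
    Heis R →ₜ* Multiplicative R where
  toFun x := Multiplicative.ofAdd x.a
  map_one' := rfl
  map_mul' _ _ := rfl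
  continuous_toFun := continuous_of_discreteTopology

/-- The projection to `b` as a homomorphism. -/
def homB (R : Type*) [CommRing R] [TopologicalSpace R] :
    Heis R →ₜ* Multiplicative R where
  toFun x := Multiplicative.ofAdd x.b
  map_one' := rfl
  map_mul' _ _ := rfl
  continuous_toFun := continuous_of_discreteTopology

theorem _root_.TripleMassey.multiplicative_zmod_pow (p : ℕ) (h : Multiplicative (ZMod p)) :
    h ^ p = 1 := by
  apply Multiplicative.toAdd.injective
  simp

/-- A continuous homomorphism to the Heisenberg group over `𝔽_p` kills `G₍₃₎`. -/
theorem zassenhaus_three_le_ker {p : ℕ} [hp : Fact p.Prime] {G : Type*} [Group G]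
    [TopologicalSpace G] [IsTopologicalGroup G] (φ : G →ₜ* Heis (ZMod p)) :
    zassenhaus G p 3 ≤ φ.toMonoidHom.ker := by
  have ha : ∀ x ∈ zassenhaus G p 2, (φ x).a = 0 := fun x hx =>
    congrArg Multiplicative.toAdd (MonoidHom.mem_ker.1 (zassenhaus_two_le_ker
      (multiplicative_zmod_pow p) ((homA (ZMod p)).comp φ) hx))
  have hb : ∀ x ∈ zassenhaus G p 2, (φ x).b = 0 := fun x hx =>
    congrArg Multiplicative.toAdd (MonoidHom.mem_ker.1 (zassenhaus_two_le_ker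
      (multiplicative_zmod_pow p) ((homB (ZMod p)).comp φ) hx))
  refine zassenhaus_le (by omega) (isClosed_ker φ) (fun x hx => ?_) fun i h1 h3 x hx y hy => ?_
  · rw [MonoidHom.mem_ker, map_pow]
    change φ x ^ p = 1
    rw [pow_eq]
    -- For odd `p` the Heisenberg group has exponent `p`. For `p = 2` it does not, but there `⌈3/2⌉
    -- = 2`, so only elements of `G₍₂₎` are raised to a power, and their images are central.
    rcases eq_or_ne p 2 with rfl | h2
    · have : 3 ⌈/⌉ 2 = 2 := rfl
      rw [this] at hx
      ext <;> simp [ha x hx, hb x hx, CharTwo.two_eq_zero]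
    · have : ((p.choose 2 : ℕ) : ZMod p) = 0 := by
        rw [ZMod.natCast_eq_zero_iff]
        exact hp.out.dvd_choose_self (by norm_num)
          (lt_of_le_of_ne hp.out.two_le (Ne.symm h2))
      ext <;> simp [this]
  · rw [MonoidHom.mem_ker]
    simp only [map_mul, map_inv]
    change (φ x)⁻¹ * (φ y)⁻¹ * φ x * φ y = 1
    -- In either case one of `x`, `y` lies in `G₍₂₎`, so its image is central.
    obtain rfl | rfl : i = 1 ∨ i = 2 := by omega
    · have h1 := ha y hy
      have h2 := hb y hy
      ext
      · simp [h1]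
      · simp [h2]
      · simp [h1, h2]; ring
    · have h1 := ha x hx
      have h2 := hb x hx
      ext <;> simp [h1, h2]

end Heis

end Heisenberg

/-! ### Coordinates on `U_4` and generation modulo commutators -/

section U4

variable {R : Type*} [CommRing R]

/-- The element of `U_4(R)` with the given entries above the diagonal. -/
def u4 (a b c d e f : R) : unitriangular 4 R :=
  ⟨⟨!![1, a, d, f; 0, 1, b, e; 0, 0, 1, c; 0, 0, 0, 1],
    !![1, -a, a * b - d, a * e + d * c - a * b * c - f; 0, 1, -b, b * c - e; 0, 0, 1, -c; 0, 0, 0, 1],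
    by
      ext i j
      fin_cases i <;> fin_cases j <;> simp [Matrix.mul_apply, Fin.sum_univ_four] <;> ring,
    by
      ext i j
      fin_cases i <;> fin_cases j <;> simp [Matrix.mul_apply, Fin.sum_univ_four] <;> ring⟩, by
    constructor
    · intro i j h
      fin_cases i <;> fin_cases j <;> simp at h ⊢
    · intro i
      fin_cases i <;> simp⟩

theorem u4_val (a b c d e f : R) : (u4 a b c d e f).1.val =
    !![1, a, d, f; 0, 1, b, e; 0, 0, 1, c; 0, 0, 0, 1] := rfl

theorem u4_mul (a b c d e f a' b' c' d' e' f' : R) :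
    u4 a b c d e f * u4 a' b' c' d' e' f' = u4 (a + a') (b + b') (c + c')
      (d + d' + a * b') (e + e' + b * c') (f + f' + a * e' + d * c') := by
  ext i j
  rw [Subgroup.coe_mul, Units.val_mul, u4_val, u4_val, u4_val]
  fin_cases i <;> fin_cases j <;> simp [Matrix.mul_apply, Fin.sum_univ_four] <;> ring

theorem u4_entries (g : unitriangular 4 R) :
    u4 (g.1.val 0 1) (g.1.val 1 2) (g.1.val 2 3) (g.1.val 0 2) (g.1.val 1 3) (g.1.val 0 3) = g := by
  obtain ⟨g, h0, h1⟩ := g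
  ext i j
  rw [u4_val]
  fin_cases i <;> fin_cases j <;> simp [h1] <;> rw [h0 _ _ (by decide)]

/-- A subgroup of `U_4(R)` that meets every coset of the commutator subgroup is everything. -/
theorem subgroup_u4_eq_top (H : Subgroup (unitriangular 4 R))
    (hH : ∀ a b c : R, ∃ d e f : R, u4 a b c d e f ∈ H) : H = ⊤ := by
  -- Here `z` is the commutator of `x` and `y`; the equation states this without inverses, so that
  -- `u4_mul` can check it.
  have hcomm : ∀ {x y z : unitriangular 4 R}, x ∈ H → y ∈ H → y * x * z = x * y → z ∈ H := by
    intro x y z hx hy h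
    have : z = (y * x)⁻¹ * (x * y) := by rw [← h]; group
    rw [this]
    exact H.mul_mem (H.inv_mem (H.mul_mem hy hx)) (H.mul_mem hx hy)
  have h2 : ∀ d e : R, ∃ f : R, u4 0 0 0 d e f ∈ H := by
    intro d e
    -- The commutator has `a * b' - a' * b` and `b * c' - b' * c` on the second diagonal, which
    -- these choices turn into `d` and `e`.
    obtain ⟨d₁, e₁, f₁, h₁⟩ := hH d 0 (-e)
    obtain ⟨d₂, e₂, f₂, h₂⟩ := hH 0 1 0
    refine ⟨d * e₂ + d₂ * e - d * e, hcomm h₁ h₂ ?_⟩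
    simp only [u4_mul]
    congr 1 <;> ring
  have h3 : ∀ f : R, u4 0 0 0 0 0 f ∈ H := by
    intro f
    obtain ⟨f₁, h₁⟩ := h2 f 0
    obtain ⟨d₂, e₂, f₂, h₂⟩ := hH 0 0 1
    refine hcomm h₁ h₂ ?_
    simp only [u4_mul]
    congr 1 <;> ring
  rw [eq_top_iff]
  rintro g -
  rw [← u4_entries g]
  generalize g.1.val 0 1 = a, g.1.val 1 2 = b, g.1.val 2 3 = c, g.1.val 0 2 = d,
    g.1.val 1 3 = e, g.1.val 0 3 = f
  obtain ⟨d₁, e₁, f₁, h₁⟩ := hH a b c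
  obtain ⟨f₂, h₂⟩ := h2 (d - d₁) (e - e₁)
  -- The last term removes the cross term `a * (e - e₁)` in the corner of the product of the first
  -- two elements.
  have h₃ := h3 (f - f₁ - f₂ - a * (e - e₁))
  have := H.mul_mem (H.mul_mem h₁ h₂) h₃
  rw [u4_mul, u4_mul] at this
  convert this using 1
  congr 1 <;> ring

end U4

/-! ### Linear independence in `H¹` -/

section Surjectivity

variable {p : ℕ} {G : Type*} [Group G] [TopologicalSpace G] [IsTopologicalGroup G]

theorem mem_ker_δ₁_iff {a : C(G, ZMod p)} :
    a ∈ LinearMap.ker (δ₁ p G) ↔ ∀ g h, a (g * h) = a g + a h := by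
  rw [LinearMap.mem_ker]
  constructor
  · intro ha g h
    have := DFunLike.congr_fun ha (g, h)
    simp only [δ₁, LinearMap.coe_mk, AddHom.coe_mk, ContinuousMap.coe_mk,
      ContinuousMap.zero_apply] at this
    linear_combination -this
  · intro ha
    ext ⟨g, h⟩
    simp [δ₁, ha]

theorem δ₁_eq_iff {a : C(G, ZMod p)} {f : C(G × G, ZMod p)} :
    δ₁ p G a = f ↔ ∀ g h, a h - a (g * h) + a g = f (g, h) :=
  ⟨fun H g h => DFunLike.congr_fun H (g, h), fun H => by ext ⟨g, h⟩; exact H g h⟩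

theorem map_mul_of_δ₁_eq {a : C(G, ZMod p)} {f : C(G × G, ZMod p)} (H : δ₁ p G a = f) (g h : G) :
    a (g * h) = a g + a h - f (g, h) := by
  linear_combination -δ₁_eq_iff.1 H g h

theorem H1.map_mul (a : H1 p G) (g h : G) : a.1 (g * h) = a.1 g + a.1 h :=
  mem_ker_δ₁_iff.1 a.2 g h

theorem H1.map_one (a : H1 p G) : a.1 1 = 0 := by
  have := a.map_mul 1 1
  rwa [mul_one, left_eq_add] at this

/-- A class in `H¹` as a continuous homomorphism. -/
def H1.toHom (a : H1 p G) : G →ₜ* Multiplicative (ZMod p) where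
  toFun g := Multiplicative.ofAdd (a.1 g)
  map_one' := by rw [a.map_one]; rfl
  map_mul' g h := by rw [a.map_mul]; rfl
  continuous_toFun := continuous_of_discreteTopology.comp a.1.continuous

/-- Finitely many classes in `H¹` are linearly independent if and only if they are the coordinates
of a surjection. -/
theorem linearIndependent_iff_surjective [Fact p.Prime] {m : ℕ} (a : Fin m → H1 p G) :
    LinearIndependent (ZMod p) a ↔ Function.Surjective fun g : G => fun i => (a i).1 g := by
  constructor
  · intro hli
    let W : AddSubgroup (Fin m → ZMod p) :=
      (MonoidHom.mk' (fun g : G => Multiplicative.ofAdd fun i => (a i).1 g)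
        (fun g h => by ext i; exact (a i).map_mul g h)).range.toAddSubgroup'
    let V : Submodule (ZMod p) (Fin m → ZMod p) := AddSubgroup.toZModSubmodule p W
    have hW : ∀ v, v ∈ V → ∃ g : G, (fun i => (a i).1 g) = v := fun v hv => hv
    have hV : V = ⊤ := by
      by_contra hne
      -- A nonzero functional vanishing on the image has coefficients that form a linear relation
      -- among the `a i`.
      obtain ⟨f, hf, hle⟩ := Submodule.exists_le_ker_of_lt_top V (lt_top_iff_ne_top.2 hne)
      refine hf (LinearMap.pi_ext' fun i => ?_)
      ext
      simp only [LinearMap.comp_apply, LinearMap.zero_apply]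
      refine Fintype.linearIndependent_iff.1 hli (fun i => f (Pi.single i 1)) ?_ i
      ext g
      have hg : f (fun i => (a i).1 g) = 0 := hle (show _ ∈ V from ⟨g, rfl⟩)
      rw [LinearMap.pi_apply_eq_sum_univ f] at hg
      have hs : ∀ i : Fin m, (fun j => if i = j then (1 : ZMod p) else 0) = Pi.single i 1 := fun i => by
        ext j
        simp only [Pi.single_apply, eq_comm]
      simp only [hs] at hg
      simpa [mul_comm] using hg
    intro v
    exact hW v (hV ▸ Submodule.mem_top)
  · intro hs
    rw [Fintype.linearIndependent_iff]
    intro c hc i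
    obtain ⟨g, hg⟩ := hs (Pi.single i 1)
    have := DFunLike.congr_fun (congrArg Subtype.val hc) g
    have hgi : ∀ j, (a j).1 g = Pi.single (M := fun _ => ZMod p) i 1 j := fun j => congrFun hg j
    simpa [hgi, Pi.single_apply] using this

end Surjectivity

/-! ### `H¹` and cup products of `S ⧸ R` -/

section Quotient

variable {p n : ℕ} [hp : Fact p.Prime] {S : Type*} [Group S] [TopologicalSpace S]
  {x : Fin n → S} {R : Subgroup S} [R.Normal]

/-- Pulled back to `S`, both maps agree on the basis, so uniqueness in the universal property
applies. -/
theorem IsFreeProPOn.hom_quotient_ext (hS : IsFreeProPOn p S x)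
    {φ ψ : (S ⧸ R) →ₜ* Multiplicative (ZMod p)}
    (h : ∀ i, φ (x i : S ⧸ R) = ψ (x i : S ⧸ R)) : φ = ψ := by
  have hP : IsPGroup p (Multiplicative (ZMod p)) := IsPGroup.of_card (n := 1) (by simp)
  let π : S →ₜ* S ⧸ R := ⟨QuotientGroup.mk' R, continuous_quot_mk⟩
  obtain ⟨_, -, hu⟩ := hS.existsUnique_lift_finite _ hP (fun i => ψ (x i : S ⧸ R))
  have := (hu (φ.comp π) h).trans (hu (ψ.comp π) fun _ => rfl).symm
  ext g
  obtain ⟨s, rfl⟩ := QuotientGroup.mk_surjective g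
  exact DFunLike.congr_fun this s

variable [IsTopologicalGroup S]

/-- Every map from the basis to the Heisenberg group over `𝔽_p` extends to a continuous
homomorphism on `S ⧸ R`, if `R ⊆ S₍₃₎`. -/
theorem IsFreeProPOn.exists_hom_heis (hS : IsFreeProPOn p S x) (hR : R ≤ zassenhaus S p 3)
    (y : Fin n → Heis (ZMod p)) :
    ∃ φ : (S ⧸ R) →ₜ* Heis (ZMod p), ∀ i, φ (x i : S ⧸ R) = y i := by
  obtain ⟨φ, hφ, -⟩ := hS.existsUnique_lift_finite _ (Heis.isPGroup p) y
  have hk : ∀ r ∈ R, φ r = 1 := fun r hr => Heis.zassenhaus_three_le_ker φ (hR hr)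
  exact ⟨⟨QuotientGroup.lift R φ.toMonoidHom hk, φ.continuous.quotient_lift _⟩, hφ⟩

theorem IsFreeProPOn.H1_ext (hS : IsFreeProPOn p S x) {a b : H1 p (S ⧸ R)}
    (h : ∀ i, a.1 (x i : S ⧸ R) = b.1 (x i : S ⧸ R)) : a = b := by
  have : a.toHom = b.toHom := hS.hom_quotient_ext fun i => congrArg Multiplicative.ofAdd (h i)
  ext g
  exact congrArg Multiplicative.toAdd (DFunLike.congr_fun this g)

/-- The `a`-coordinate of a homomorphism to the Heisenberg group, as a class in `H¹`. -/
def Heis.classA {G : Type*} [Group G] [TopologicalSpace G] [IsTopologicalGroup G]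
    (φ : G →ₜ* Heis (ZMod p)) : H1 p G :=
  ⟨⟨fun g => (φ g).a, continuous_of_discreteTopology.comp φ.continuous⟩,
    mem_ker_δ₁_iff.2 fun g h => by simp⟩

/-- The `b`-coordinate of a homomorphism to the Heisenberg group, as a class in `H¹`. -/
def Heis.classB {G : Type*} [Group G] [TopologicalSpace G] [IsTopologicalGroup G]
    (φ : G →ₜ* Heis (ZMod p)) : H1 p G :=
  ⟨⟨fun g => (φ g).b, continuous_of_discreteTopology.comp φ.continuous⟩,
    mem_ker_δ₁_iff.2 fun g h => by simp⟩

/-- Evaluation on the basis identifies `H¹(S ⧸ R, 𝔽_p)` with `𝔽_p ^ n`. -/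
theorem IsFreeProPOn.bijective_H1_eval (hS : IsFreeProPOn p S x) (hR : R ≤ zassenhaus S p 3) :
    Function.Bijective fun (a : H1 p (S ⧸ R)) (i : Fin n) => a.1 (x i : S ⧸ R) := by
  refine ⟨fun a b h => hS.H1_ext (congrFun h), fun y => ?_⟩
  obtain ⟨φ, hφ⟩ := hS.exists_hom_heis hR fun i => ⟨y i, 0, 0⟩
  exact ⟨Heis.classA φ, funext fun i => congrArg Heis.a (hφ i)⟩

/-- Cup products of classes in `H¹(S ⧸ R, 𝔽_p)` vanish if `R ⊆ S₍₃₎`. -/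
theorem IsFreeProPOn.exists_δ₁_eq_cup (hS : IsFreeProPOn p S x) (hR : R ≤ zassenhaus S p 3)
    (a b : H1 p (S ⧸ R)) : ∃ w : C(S ⧸ R, ZMod p), δ₁ p (S ⧸ R) w = cup a.1 b.1 := by
  obtain ⟨φ, hφ⟩ := hS.exists_hom_heis hR fun i => ⟨a.1 (x i : S ⧸ R), b.1 (x i : S ⧸ R), 0⟩
  have ha : Heis.classA φ = a := hS.H1_ext fun i => congrArg Heis.a (hφ i)
  have hb : Heis.classB φ = b := hS.H1_ext fun i => congrArg Heis.b (hφ i)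
  -- The sign is needed because the corner satisfies `δc = -(a ∪ b)`.
  refine ⟨-⟨fun g => (φ g).c, continuous_of_discreteTopology.comp φ.continuous⟩,
    δ₁_eq_iff.2 fun g h => ?_⟩
  rw [← ha, ← hb]
  simp [cup, Heis.classA, Heis.classB]
  ring

end Quotient

/-! ### Epimorphisms to `U_4` as Massey data -/

section Count

variable {p : ℕ} {G : Type*} [Group G] [TopologicalSpace G]

/-- The entries of a homomorphism to `U_4(𝔽_p)` as continuous cochains. -/
def entry (φ : G →ₜ* unitriangular 4 (ZMod p)) (i j : Fin 4) : C(G, ZMod p) :=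
  ⟨fun g => (φ g).1.val i j,
    (Units.continuous_val.comp (continuous_subtype_val.comp φ.continuous)).matrix_elem i j⟩

theorem u4_entry (φ : G →ₜ* unitriangular 4 (ZMod p)) (g : G) :
    u4 (entry φ 0 1 g) (entry φ 1 2 g) (entry φ 2 3 g) (entry φ 0 2 g) (entry φ 1 3 g)
      (entry φ 0 3 g) = φ g :=
  u4_entries _

theorem hom_u4_ext {φ ψ : G →ₜ* unitriangular 4 (ZMod p)} (h01 : entry φ 0 1 = entry ψ 0 1)
    (h12 : entry φ 1 2 = entry ψ 1 2) (h23 : entry φ 2 3 = entry ψ 2 3)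
    (h02 : entry φ 0 2 = entry ψ 0 2) (h13 : entry φ 1 3 = entry ψ 1 3)
    (h03 : entry φ 0 3 = entry ψ 0 3) : φ = ψ := by
  ext1 g
  rw [← u4_entry φ, ← u4_entry ψ, h01, h12, h23, h02, h13, h03]

/-- The entries multiply like those of matrices. -/
theorem entry_mul (φ : G →ₜ* unitriangular 4 (ZMod p)) (g h : G) :
    entry φ 0 1 (g * h) = entry φ 0 1 g + entry φ 0 1 h ∧
    entry φ 1 2 (g * h) = entry φ 1 2 g + entry φ 1 2 h ∧
    entry φ 2 3 (g * h) = entry φ 2 3 g + entry φ 2 3 h ∧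
    entry φ 0 2 (g * h) = entry φ 0 2 g + entry φ 0 2 h + entry φ 0 1 g * entry φ 1 2 h ∧
    entry φ 1 3 (g * h) = entry φ 1 3 g + entry φ 1 3 h + entry φ 1 2 g * entry φ 2 3 h ∧
    entry φ 0 3 (g * h) = entry φ 0 3 g + entry φ 0 3 h + entry φ 0 1 g * entry φ 1 3 h +
      entry φ 0 2 g * entry φ 2 3 h := by
  have H := map_mul φ g h
  rw [← u4_entry φ g, ← u4_entry φ h, u4_mul] at H
  have e : ∀ i j, entry φ i j (g * h) = (φ (g * h)).1.val i j := fun _ _ => rfl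
  refine ⟨?_, ?_, ?_, ?_, ?_, ?_⟩ <;> rw [e, H, u4_val] <;> simp

/-- The homomorphism to `U_4(𝔽_p)` with given entries. -/
def homU4 (a b c d e f : C(G, ZMod p)) (ha : ∀ g h, a (g * h) = a g + a h)
    (hb : ∀ g h, b (g * h) = b g + b h) (hc : ∀ g h, c (g * h) = c g + c h)
    (hd : ∀ g h, d (g * h) = d g + d h + a g * b h)
    (he : ∀ g h, e (g * h) = e g + e h + b g * c h)
    (hf : ∀ g h, f (g * h) = f g + f h + a g * e h + d g * c h) :
    G →ₜ* unitriangular 4 (ZMod p) where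
  toMonoidHom := MonoidHom.mk' (fun g => u4 (a g) (b g) (c g) (d g) (e g) (f g)) fun g h => by
    rw [u4_mul, ha, hb, hc, hd, he, hf]
  continuous_toFun := by
    let F : ZMod p × ZMod p × ZMod p × ZMod p × ZMod p × ZMod p → unitriangular 4 (ZMod p) :=
      fun t => u4 t.1 t.2.1 t.2.2.1 t.2.2.2.1 t.2.2.2.2.1 t.2.2.2.2.2
    have hF : Continuous F := continuous_of_discreteTopology
    exact hF.comp (a.continuous.prodMk (b.continuous.prodMk (c.continuous.prodMk
      (d.continuous.prodMk (e.continuous.prodMk f.continuous)))))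

variable [IsTopologicalGroup G]

/-- A homomorphism to `U_4(𝔽_p)` is surjective if and only if its entries next to the diagonal
are linearly independent. -/
theorem surjective_iff_linearIndependent [Fact p.Prime] (φ : G →ₜ* unitriangular 4 (ZMod p))
    (a b c : H1 p G) (ha : entry φ 0 1 = a.1) (hb : entry φ 1 2 = b.1)
    (hc : entry φ 2 3 = c.1) :
    Function.Surjective φ ↔ LinearIndependent (ZMod p) ![a, b, c] := by
  rw [linearIndependent_iff_surjective]
  constructor
  · intro hs v
    obtain ⟨g, hg⟩ := hs (u4 (v 0) (v 1) (v 2) 0 0 0)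
    refine ⟨g, funext fun i => ?_⟩
    fin_cases i
    · simp [← ha, entry, hg, u4_val]
    · simp [← hb, entry, hg, u4_val]
    · simp [← hc, entry, hg, u4_val]
  · intro hs
    have : φ.toMonoidHom.range = ⊤ := by
      refine subgroup_u4_eq_top _ fun α β γ => ?_
      obtain ⟨g, hg⟩ := hs ![α, β, γ]
      have h0 : entry φ 0 1 g = α := by simpa [ha] using congrFun hg 0
      have h1 : entry φ 1 2 g = β := by simpa [hb] using congrFun hg 1
      have h2 : entry φ 2 3 g = γ := by simpa [hc] using congrFun hg 2
      refine ⟨entry φ 0 2 g, entry φ 1 3 g, entry φ 0 3 g, g, ?_⟩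
      rw [← h0, ← h1, ← h2, u4_entry]
      rfl
    exact MonoidHom.range_eq_top.1 this

/-- Containing `0` already makes the Massey product nonempty, and a value is `0` exactly when its
cochain is a coboundary. -/
theorem mem_TMP_iff (a b c : H1 p G) : (a, b, c) ∈ TMP p G ↔
    (∃ (M : DefiningSystem a b c) (f : C(G, ZMod p)), δ₁ p G f = M.cochain) ∧
      LinearIndependent (ZMod p) ![a, b, c] := by
  have key : 0 ∈ masseyProduct a b c ↔
      ∃ (M : DefiningSystem a b c) (f : C(G, ZMod p)), δ₁ p G f = M.cochain := by
    refine exists_congr fun M => ?_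
    change M.value = 0 ↔ _
    rw [DefiningSystem.value, Submodule.Quotient.mk_eq_zero]
    rfl
  constructor
  · rintro ⟨-, h, hli⟩
    exact ⟨key.1 h, hli⟩
  · rintro ⟨h, hli⟩
    exact ⟨⟨0, key.2 h⟩, key.2 h, hli⟩

/-- If all cup products of classes in `H¹` vanish, then epimorphisms to `U_4(𝔽_p)` are
parametrized by a triple in `TMP` and three classes in `H¹`. -/
theorem exists_equiv_epi [Fact p.Prime]
    (hcup : ∀ a b : H1 p G, ∃ w : C(G, ZMod p), δ₁ p G w = cup a.1 b.1) :
    Nonempty (TMP p G × H1 p G × H1 p G × H1 p G ≃ Epi G (unitriangular 4 (ZMod p))) := by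
  choose W hW using hcup
  have hT := fun t : TMP p G => ((mem_TMP_iff t.1.1 t.1.2.1 t.1.2.2).1 t.2).1
  choose M f hf using hT
  have hW' : ∀ a b : H1 p G, ∀ g h, W a b (g * h) = W a b g + W a b h - a.1 g * b.1 h :=
    fun a b => map_mul_of_δ₁_eq (hW a b)
  have h13 : ∀ t : TMP p G, ∀ g h, (M t).a₁₃ (g * h) =
      (M t).a₁₃ g + (M t).a₁₃ h - t.1.1.1 g * t.1.2.1.1 h :=
    fun t => map_mul_of_δ₁_eq (M t).δ_a₁₃
  have h24 : ∀ t : TMP p G, ∀ g h, (M t).a₂₄ (g * h) =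
      (M t).a₂₄ g + (M t).a₂₄ h - t.1.2.1.1 g * t.1.2.2.1 h :=
    fun t => map_mul_of_δ₁_eq (M t).δ_a₂₄
  have hf' : ∀ t : TMP p G, ∀ g h, f t (g * h) = f t g + f t h -
      (t.1.1.1 g * (M t).a₂₄ h + (M t).a₁₃ g * t.1.2.2.1 h) :=
    fun t => map_mul_of_δ₁_eq (hf t)
  -- The second diagonal is negated because matrix entries satisfy `δd = -(a ∪ b)`; the corner then
  -- needs no sign. The `W` terms bound the change `a ∪ v + u ∪ c` of the Massey cochain caused by
  -- `u` and `v`.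
  let Φ : TMP p G × H1 p G × H1 p G × H1 p G → (G →ₜ* unitriangular 4 (ZMod p)) := fun q =>
    homU4 q.1.1.1.1 q.1.1.2.1.1 q.1.1.2.2.1 (-((M q.1).a₁₃ + q.2.1.1))
      (-((M q.1).a₂₄ + q.2.2.1.1))
      (f q.1 + W q.1.1.1 q.2.2.1 + W q.2.1 q.1.1.2.2 + q.2.2.2.1)
      (H1.map_mul _) (H1.map_mul _) (H1.map_mul _)
      (fun g h => by
        simp only [ContinuousMap.neg_apply, ContinuousMap.add_apply, h13, H1.map_mul]; ring)
      (fun g h => by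
        simp only [ContinuousMap.neg_apply, ContinuousMap.add_apply, h24, H1.map_mul]; ring)
      (fun g h => by
        simp only [ContinuousMap.neg_apply, ContinuousMap.add_apply, hf', hW', H1.map_mul]; ring)
  have e01 : ∀ q, entry (Φ q) 0 1 = q.1.1.1.1 := fun q => rfl
  have e12 : ∀ q, entry (Φ q) 1 2 = q.1.1.2.1.1 := fun q => rfl
  have e23 : ∀ q, entry (Φ q) 2 3 = q.1.1.2.2.1 := fun q => rfl
  have e02 : ∀ q, entry (Φ q) 0 2 = -((M q.1).a₁₃ + q.2.1.1) := fun q => rfl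
  have e13 : ∀ q, entry (Φ q) 1 3 = -((M q.1).a₂₄ + q.2.2.1.1) := fun q => rfl
  have e03 : ∀ q, entry (Φ q) 0 3 =
      f q.1 + W q.1.1.1 q.2.2.1 + W q.2.1 q.1.1.2.2 + q.2.2.2.1 := fun q => rfl
  have hsurj : ∀ q, Φ q ∈ Epi G (unitriangular 4 (ZMod p)) := fun q =>
    (surjective_iff_linearIndependent (Φ q) _ _ _ (e01 q) (e12 q) (e23 q)).2 q.1.2.2.2
  refine ⟨Equiv.ofBijective (fun q => ⟨Φ q, hsurj q⟩) ⟨?_, ?_⟩⟩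
  · intro q q' hq
    have hΦ : Φ q = Φ q' := congrArg Subtype.val hq
    -- The triple comes first, since it fixes the chosen `M` and `f`; `w` comes last, since its
    -- correction terms depend on `u` and `v`.
    have ht : q.1 = q'.1 := by
      refine Subtype.ext (Prod.ext ?_ (Prod.ext ?_ ?_)) <;> apply Subtype.ext
      · rw [← e01 q, ← e01 q', hΦ]
      · rw [← e12 q, ← e12 q', hΦ]
      · rw [← e23 q, ← e23 q', hΦ]
    obtain ⟨t, u, v, w⟩ := q
    obtain ⟨t', u', v', w'⟩ := q'
    obtain rfl : t = t' := ht
    obtain rfl : u = u' := by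
      have := e02 (t, u, v, w)
      rw [hΦ, e02] at this
      exact Subtype.ext (add_left_cancel (neg_injective this)).symm
    obtain rfl : v = v' := by
      have := e13 (t, u, v, w)
      rw [hΦ, e13] at this
      exact Subtype.ext (add_left_cancel (neg_injective this)).symm
    obtain rfl : w = w' := by
      have := e03 (t, u, v, w)
      rw [hΦ, e03] at this
      exact Subtype.ext (add_left_cancel this).symm
    rfl
  · rintro ⟨φ, hφ⟩
    let a : H1 p G := ⟨entry φ 0 1, mem_ker_δ₁_iff.2 fun g h => (entry_mul φ g h).1⟩
    let b : H1 p G := ⟨entry φ 1 2, mem_ker_δ₁_iff.2 fun g h => (entry_mul φ g h).2.1⟩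
    let c : H1 p G := ⟨entry φ 2 3, mem_ker_δ₁_iff.2 fun g h => (entry_mul φ g h).2.2.1⟩
    let N : DefiningSystem a b c :=
      { a₁₃ := -entry φ 0 2
        a₂₄ := -entry φ 1 3
        δ_a₁₃ := δ₁_eq_iff.2 fun g h => by
          change -entry φ 0 2 h - -entry φ 0 2 (g * h) + -entry φ 0 2 g =
            entry φ 0 1 g * entry φ 1 2 h
          linear_combination (entry_mul φ g h).2.2.2.1
        δ_a₂₄ := δ₁_eq_iff.2 fun g h => by
          change -entry φ 1 3 h - -entry φ 1 3 (g * h) + -entry φ 1 3 g =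
            entry φ 1 2 g * entry φ 2 3 h
          linear_combination (entry_mul φ g h).2.2.2.2.1 }
    have hN : δ₁ p G (entry φ 0 3) = N.cochain := δ₁_eq_iff.2 fun g h => by
      change entry φ 0 3 h - entry φ 0 3 (g * h) + entry φ 0 3 g =
        entry φ 0 1 g * -entry φ 1 3 h + -entry φ 0 2 g * entry φ 2 3 h
      linear_combination -(entry_mul φ g h).2.2.2.2.2
    let t : TMP p G := ⟨(a, b, c), (mem_TMP_iff a b c).2 ⟨⟨N, _, hN⟩,
      (surjective_iff_linearIndependent φ a b c rfl rfl rfl).1 hφ⟩⟩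
    -- The defining system of `φ` and the chosen one have the same coboundaries, so their
    -- differences are classes in `H¹`.
    let u : H1 p G := ⟨-entry φ 0 2 - (M t).a₁₃, by
      rw [LinearMap.mem_ker, map_sub, (M t).δ_a₁₃, sub_eq_zero]
      exact N.δ_a₁₃⟩
    let v : H1 p G := ⟨-entry φ 1 3 - (M t).a₂₄, by
      rw [LinearMap.mem_ker, map_sub, (M t).δ_a₂₄, sub_eq_zero]
      exact N.δ_a₂₄⟩
    -- By the choice of `u` and `v`, both the corner of `φ` and the corrected `f t` bound the
    -- cochain of `N`.
    let w : H1 p G := ⟨entry φ 0 3 - (f t + W a v + W u c), by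
      rw [LinearMap.mem_ker, map_sub, map_add, map_add, hN, hf, hW, hW, sub_eq_zero]
      ext ⟨g, h⟩
      change entry φ 0 1 g * -entry φ 1 3 h + -entry φ 0 2 g * entry φ 2 3 h =
        entry φ 0 1 g * (M t).a₂₄ h + (M t).a₁₃ g * entry φ 2 3 h +
        entry φ 0 1 g * (-entry φ 1 3 h - (M t).a₂₄ h) +
        (-entry φ 0 2 g - (M t).a₁₃ g) * entry φ 2 3 h
      ring⟩
    refine ⟨(t, u, v, w), Subtype.ext (hom_u4_ext rfl rfl rfl ?_ ?_ ?_)⟩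
    · change entry (Φ _) _ _ = _
      rw [e02]
      change -((M t).a₁₃ + (-entry φ 0 2 - (M t).a₁₃)) = _
      abel
    · change entry (Φ _) _ _ = _
      rw [e13]
      change -((M t).a₂₄ + (-entry φ 1 3 - (M t).a₂₄)) = _
      abel
    · change entry (Φ _) _ _ = _
      rw [e03]
      change f t + W a v + W u c + (entry φ 0 3 - (f t + W a v + W u c)) = _
      abel

end Count

end TripleMassey

/-! ### The count -/

theorem mainTheorem7 (p : ℕ) [Fact p.Prime] (n : ℕ)
    (S : Type*) [Group S] [TopologicalSpace S] [IsTopologicalGroup S]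
    (hS : TripleMassey.IsFreeProPOfRank p n S)
    (R : Subgroup S) [R.Normal] (hR : R ≤ TripleMassey.zassenhaus S p 3) :
    (TripleMassey.Epi (S ⧸ R) (TripleMassey.unitriangular 4 (ZMod p))).Finite ∧
    (TripleMassey.TMP p (S ⧸ R)).Finite ∧
    (TripleMassey.Epi (S ⧸ R) (TripleMassey.unitriangular 4 (ZMod p))).ncard =
      (TripleMassey.TMP p (S ⧸ R)).ncard * p ^ (3 * n) := by
  obtain ⟨x, hx⟩ := hS
  have hb := hx.bijective_H1_eval hR
  have hfin : Finite (TripleMassey.H1 p (S ⧸ R)) := Finite.of_injective _ hb.1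
  have hcard : Nat.card (TripleMassey.H1 p (S ⧸ R)) = p ^ n := by
    rw [Nat.card_congr (Equiv.ofBijective _ hb)]
    simp
  have hT : (TripleMassey.TMP p (S ⧸ R)).Finite := Set.toFinite _
  have := hT.to_subtype
  obtain ⟨e⟩ := TripleMassey.exists_equiv_epi (hx.exists_δ₁_eq_cup hR)
  refine ⟨@Set.toFinite _ _ (Finite.of_equiv _ e), hT, ?_⟩
  rw [← Nat.card_coe_set_eq, ← Nat.card_coe_set_eq, ← Nat.card_congr e]
  -- The three copies of `H¹` contribute `(p ^ n) ^ 3`.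
  simp only [Nat.card_prod, hcard]
  ring
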